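/- Let $m_1,m_2\ge 0$ be integers with $m=m_1+m_2>0$, let $p\le m$, let $n\ge 1$, let $r\ge0$ be an integer, let $j=\mathrm{diag}\{I_{m_1},-I_{m_2}\}$, and let $\mathcal I\subset\mathbb R$ be an interval with $0\in\mathcal I$. Let $c_1,\dots,c_r\in\mathbb R$, and let $\beta_k:\mathcal I\to\mathbb C^{p\times m}$ $(1\le k\le r)$ be such that the Hamiltonians $H_k=\beta_k^*\beta_k$ are locally summable on $\mathcal I$. Let $A,S(0)\in\mathbb C^{n\times n}$ and $\Pi(0)\in\mathbb C^{n\times m}$ satisfy $$c_k\notin\sigma(A)\ (1\le k\le r),\qquad AS(0)-S(0)A^*=\mathrm i\,\Pi(0)j\Pi(0)^*,\qquad S(0)=S(0)^*.$$ Let $\Pi:\mathcal I\to\mathbb C^{n\times m}$ and $S:\mathcal I\to\mathbb C^{n\times n}$ be locally absolutely continuous functions with these values at $0$ which satisfy, almost everywhere on $\mathcal I$, $$\Pi'(x)=-\mathrm i\sum_{k=1}^r(A-c_kI_n)^{-1}\Pi(x)jH_k(x),\tag{1}$$ $$S'(x)=-\sum_{k=1}^r(A-c_kI_n)^{-1}\Pi(x)jH_k(x)j\Pi(x)^*(A^*-c_kI_n)^{-1}.\tag{2}$$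 At the points of $\mathcal I$ where $S(x)$ is invertible, put, for $z\notin\sigma(A)$, $$w_A(x,z)=I_m-\mathrm i\,j\Pi(x)^*S(x)^{-1}(A-zI_n)^{-1}\Pi(x),\qquad \widetilde\beta_k(x)=\beta_k(x)\,j\,w_A(x,c_k)^*j,\qquad \widetilde H_k(x)=\widetilde\beta_k(x)^*\widetilde\beta_k(x),$$ and, for $\zeta=(\zeta_1,\dots,\zeta_r)\in\mathbb C^r$, define the $m\times n$ matrix function $$\widetilde\psi(x,\zeta_1,\dots,\zeta_r)=j\Pi(x)^*S(x)^{-1}\exp\Big\{\sum_{k=1}^r\zeta_k(A-c_kI_n)^{-1}\Big\}.$$ Then, for every $\zeta$, the function $x\mapsto\widetilde\psi(x,\zeta)$ is absolutely continuous on every compact interval contained in $\{x\in\mathcal I:\ S(x)\text{ is invertible}\}$. Moreover, for almost every $x\in\mathcal I$ at which $S(x)$ is invertible, all the partial derivatives below exist for all $\zeta\in\mathbb C^r$, and $$\frac{\partial\widetilde\psi}{\partial x}=\mathrm i\sum_{k=1}^r j\widetilde H_k(x)\frac{\partial\widetilde\psi}{\partial\zeta_k}\qquad\text{for all }\zeta\in\mathbb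 C^r.\tag{3}$$ More precisely, this holds at every $x\in\mathcal I$ at which $S(x)$ is invertible and $\Pi$ and $S$ have derivatives satisfying (1) and (2) (derivatives in $x$ being one-sided at an end point of $\mathcal I$). -/

import Mathlib

open Matrix MeasureTheory

namespace GBDT

noncomputable section

/-- Entrywise derivative of a matrix function of a real or complex variable within a set. -/
def HasMatDerivWithinAt {𝕜 : Type} [NontriviallyNormedField 𝕜] [NormedAlgebra 𝕜 ℂ]
    {a b : Type} (F : 𝕜 → Matrix a b ℂ) (F' : Matrix a b ℂ) (s : Set 𝕜) (x : 𝕜) : Prop :=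
  ∀ i j, HasDerivWithinAt (fun t => F t i j) (F' i j) s x

/-- Absolute continuity (entrywise) of a matrix function on every compact interval contained
in the set `D`. -/
def LocallyAbsContOn {a b : Type} (F : ℝ → Matrix a b ℂ) (D : Set ℝ) : Prop :=
  ∀ s t : ℝ, Set.uIcc s t ⊆ D →
    ∀ i j, AbsolutelyContinuousOnInterval (fun x => F x i j) s t

/-- `F' = V` on the interval `I` in the Carathéodory sense: `F` is locally absolutely continuous
on `I`, and the equation holds at almost every point of `I`. -/
def SolvesODEOn {a b : Type} (F V : ℝ → Matrix a b ℂ) (I : Set ℝ) : Prop :=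
  LocallyAbsContOn F I ∧ ∀ᵐ x : ℝ, x ∈ I → HasMatDerivWithinAt F (V x) I x

/-- The signature matrix `diag(I_{m₁}, -I_{m₂})`. -/
def sigMat (m₁ m₂ : ℕ) : Matrix (Fin m₁ ⊕ Fin m₂) (Fin m₁ ⊕ Fin m₂) ℂ :=
  Matrix.fromBlocks 1 0 0 (-1)

/-- The inverse `(A - z I_n)⁻¹`. -/
def resolv {n : ℕ} (A : Matrix (Fin n) (Fin n) ℂ) (z : ℂ) : Matrix (Fin n) (Fin n) ℂ :=
  (A - z • (1 : Matrix (Fin n) (Fin n) ℂ))⁻¹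

variable {m₁ m₂ p n r : ℕ}

/-- The Hamiltonians `H_k = β_k^* β_k`. -/
def ham (β : Fin r → ℝ → Matrix (Fin p) (Fin m₁ ⊕ Fin m₂) ℂ) (k : Fin r) (x : ℝ) :
    Matrix (Fin m₁ ⊕ Fin m₂) (Fin m₁ ⊕ Fin m₂) ℂ :=
  (β k x)ᴴ * β k x

/-- The right-hand side `-i ∑ (A - c_k)⁻¹ Π j H_k` of the equation for `Π'`. -/
def rhsPi (A : Matrix (Fin n) (Fin n) ℂ) (c : Fin r → ℝ)
    (β : Fin r → ℝ → Matrix (Fin p) (Fin m₁ ⊕ Fin m₂) ℂ)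
    (P : ℝ → Matrix (Fin n) (Fin m₁ ⊕ Fin m₂) ℂ) (x : ℝ) :
    Matrix (Fin n) (Fin m₁ ⊕ Fin m₂) ℂ :=
  -(Complex.I • ∑ k, resolv A (c k) * P x * sigMat m₁ m₂ * ham β k x)

/-- The right-hand side `-∑ (A - c_k)⁻¹ Π j H_k j Π^* (A^* - c_k)⁻¹` of the equation for `S'`. -/
def rhsS (A : Matrix (Fin n) (Fin n) ℂ) (c : Fin r → ℝ)
    (β : Fin r → ℝ → Matrix (Fin p) (Fin m₁ ⊕ Fin m₂) ℂ)
    (P : ℝ → Matrix (Fin n) (Fin m₁ ⊕ Fin m₂) ℂ) (x : ℝ) : Matrix (Fin n) (Fin n) ℂ :=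
  -∑ k, resolv A (c k) * P x * sigMat m₁ m₂ * ham β k x * sigMat m₁ m₂ * (P x)ᴴ *
    resolv Aᴴ (c k)

/-- The transfer matrix function `w_A(x, z) = I_m - i j Π(x)^* S(x)⁻¹ (A - z I_n)⁻¹ Π(x)`. -/
def transfer (A : Matrix (Fin n) (Fin n) ℂ)
    (P : ℝ → Matrix (Fin n) (Fin m₁ ⊕ Fin m₂) ℂ) (S : ℝ → Matrix (Fin n) (Fin n) ℂ)
    (x : ℝ) (z : ℂ) : Matrix (Fin m₁ ⊕ Fin m₂) (Fin m₁ ⊕ Fin m₂) ℂ :=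
  1 - Complex.I • (sigMat m₁ m₂ * (P x)ᴴ * (S x)⁻¹ * resolv A z * P x)

/-- `β̃_k(x) = β_k(x) j w_A(x, c_k)^* j`. -/
def transBeta (A : Matrix (Fin n) (Fin n) ℂ) (c : Fin r → ℝ)
    (β : Fin r → ℝ → Matrix (Fin p) (Fin m₁ ⊕ Fin m₂) ℂ)
    (P : ℝ → Matrix (Fin n) (Fin m₁ ⊕ Fin m₂) ℂ) (S : ℝ → Matrix (Fin n) (Fin n) ℂ)
    (k : Fin r) (x : ℝ) : Matrix (Fin p) (Fin m₁ ⊕ Fin m₂) ℂ :=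
  β k x * sigMat m₁ m₂ * (transfer A P S x (c k))ᴴ * sigMat m₁ m₂

/-- `ψ̃(x, ζ) = j Π(x)^* S(x)⁻¹ exp(∑ ζ_k (A - c_k I_n)⁻¹)`. -/
def psiTilde (A : Matrix (Fin n) (Fin n) ℂ) (c : Fin r → ℝ)
    (P : ℝ → Matrix (Fin n) (Fin m₁ ⊕ Fin m₂) ℂ) (S : ℝ → Matrix (Fin n) (Fin n) ℂ)
    (x : ℝ) (ζ : Fin r → ℂ) : Matrix (Fin m₁ ⊕ Fin m₂) (Fin n) ℂ :=
  sigMat m₁ m₂ * (P x)ᴴ * (S x)⁻¹ * NormedSpace.exp (∑ k, ζ k • resolv A (c k))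

/-- At the point `x` of the interval `I`, and for every `ζ`, all partial derivatives of `ψ` exist
and `∂ψ/∂x = i ∑ j K_k(x) ∂ψ/∂ζ_k`. Here `D k` is `∂ψ/∂ζ_k`; the `x`-derivative is taken
within `I`, so it is one-sided at an end point of `I`. -/
def DynSystemAt (K : Fin r → ℝ → Matrix (Fin m₁ ⊕ Fin m₂) (Fin m₁ ⊕ Fin m₂) ℂ)
    (ψ : ℝ → (Fin r → ℂ) → Matrix (Fin m₁ ⊕ Fin m₂) (Fin n) ℂ) (I : Set ℝ) (x : ℝ) : Prop :=
  ∀ ζ : Fin r → ℂ, ∃ D : Fin r → Matrix (Fin m₁ ⊕ Fin m₂) (Fin n) ℂ,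
    (∀ k, HasMatDerivWithinAt (fun s : ℂ => ψ x (Function.update ζ k s)) (D k) Set.univ (ζ k)) ∧
    HasMatDerivWithinAt (fun t : ℝ => ψ t ζ)
      (Complex.I • ∑ k, sigMat m₁ m₂ * K k x * D k) I x

end

end GBDT

/-! Write `R_k = (A - c_k)⁻¹`. Two identities known at `0` persist on all of `I`: `S = S^*` and `A S
- S A^* = i Π j Π^*`. In each, the difference of the two sides is locally absolutely continuous with
zero derivative almost everywhere (`conjTranspose_eq_of_solvesODEOn`, `node_of_solvesODEOn`). At a
point where `S` is invertible, the product rule gives `(j Π^* S⁻¹)' = i ∑ w_A(x, c_k) j H_k j Π^*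
R_k^* S⁻¹`. The second identity yields `w_A(x, c_k)^* Π^* S⁻¹ R_k = Π^* R_k^* S⁻¹`
(`transfer_conjTranspose_mul`), which turns this into `i ∑ j H̃_k (j Π^* S⁻¹) R_k`. Since the `R_k`
commute, `∂/∂ζ_k` inserts `R_k` in front of the exponential, and the system follows. -/

/-! ### Absolute continuity of scalar functions. -/

theorem AbsolutelyContinuousOnInterval.lipschitzOnWith_comp {X Y : Type*} [PseudoMetricSpace X]
    [PseudoMetricSpace Y] {f : ℝ → X} {g : X → Y} {K : NNReal} {a b : ℝ}
    (hf : AbsolutelyContinuousOnInterval f a b)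
    (hg : LipschitzOnWith K g (f '' Set.uIcc a b)) :
    AbsolutelyContinuousOnInterval (fun x => g (f x)) a b := by
  refine squeeze_zero' (g := fun E => (K : ℝ) * ∑ i ∈ Finset.range E.1,
    dist (f (E.2 i).1) (f (E.2 i).2)) (.of_forall fun E => Finset.sum_nonneg fun _ _ => dist_nonneg)
    ?_ (by simpa using Filter.Tendsto.const_mul (K : ℝ) hf)
  filter_upwards [Filter.mem_inf_of_right (Filter.mem_principal_self _)] with E hE
  rw [Finset.mul_sum]
  exact Finset.sum_le_sum fun i hi => hg.dist_le_mul _ (Set.mem_image_of_mem f (hE.1 i hi).1) _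
    (Set.mem_image_of_mem f (hE.1 i hi).2)

theorem AbsolutelyContinuousOnInterval.const {X : Type*} [PseudoMetricSpace X] (z : X) (a b : ℝ) :
    AbsolutelyContinuousOnInterval (fun _ => z) a b :=
  (LipschitzWith.const (α := ℝ) z).lipschitzOnWith.absolutelyContinuousOnInterval

theorem AbsolutelyContinuousOnInterval.complex_mul {f g : ℝ → ℂ} {a b : ℝ}
    (hf : AbsolutelyContinuousOnInterval f a b) (hg : AbsolutelyContinuousOnInterval g a b) :
    AbsolutelyContinuousOnInterval (fun x => f x * g x) a b :=
  hf.smul hg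

theorem AbsolutelyContinuousOnInterval.complex_star {f : ℝ → ℂ} {a b : ℝ}
    (hf : AbsolutelyContinuousOnInterval f a b) :
    AbsolutelyContinuousOnInterval (fun x => star (f x)) a b :=
  hf.lipschitzOnWith_comp (g := star) (K := 1)
    (LipschitzOnWith.of_dist_le_mul fun x _ y _ => by
      rw [dist_eq_norm, dist_eq_norm, ← star_sub, norm_star, NNReal.coe_one, one_mul])

theorem AbsolutelyContinuousOnInterval.finset_sum {ι : Type*} (s : Finset ι) {f : ι → ℝ → ℂ}
    {a b : ℝ} (hf : ∀ i ∈ s, AbsolutelyContinuousOnInterval (f i) a b) :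
    AbsolutelyContinuousOnInterval (fun x => ∑ i ∈ s, f i x) a b := by
  classical
  induction s using Finset.induction_on with
  | empty => simpa using const (0 : ℂ) a b
  | insert i s hi ih =>
    simp only [Finset.sum_insert hi]
    exact (hf i (by simp)).fun_add (ih fun j hj => hf j (by simp [hj]))

theorem AbsolutelyContinuousOnInterval.finset_prod {ι : Type*} (s : Finset ι) {f : ι → ℝ → ℂ}
    {a b : ℝ} (hf : ∀ i ∈ s, AbsolutelyContinuousOnInterval (f i) a b) :
    AbsolutelyContinuousOnInterval (fun x => ∏ i ∈ s, f i x) a b := by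
  classical
  induction s using Finset.induction_on with
  | empty => simpa using const (1 : ℂ) a b
  | insert i s hi ih =>
    simp only [Finset.prod_insert hi]
    exact (hf i (by simp)).complex_mul (ih fun j hj => hf j (by simp [hj]))

theorem AbsolutelyContinuousOnInterval.complex_inv {f : ℝ → ℂ} {a b : ℝ}
    (hf : AbsolutelyContinuousOnInterval f a b) (h0 : ∀ x ∈ Set.uIcc a b, f x ≠ 0) :
    AbsolutelyContinuousOnInterval (fun x => (f x)⁻¹) a b := by
  obtain ⟨C, hC⟩ := isCompact_uIcc.exists_bound_of_continuousOn (hf.continuousOn.inv₀ h0)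
  have hC0 : 0 ≤ C := (norm_nonneg _).trans (hC a Set.left_mem_uIcc)
  -- `C` bounds `|1/f|` on the interval, and `1/u - 1/v = (v - u)/(uv)`.
  refine hf.lipschitzOnWith_comp (g := fun z => z⁻¹) (K := ⟨C * C, mul_nonneg hC0 hC0⟩)
    (LipschitzOnWith.of_dist_le_mul ?_)
  rintro _ ⟨x, hx, rfl⟩ _ ⟨y, hy, rfl⟩
  rw [dist_eq_norm, dist_eq_norm, inv_sub_inv' (h0 x hx) (h0 y hy), norm_mul, norm_mul,
    norm_sub_rev (f y)]
  change _ ≤ C * C * _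
  have hx' := hC x hx
  have hy' := hC y hy
  rw [Pi.inv_apply] at hx' hy'
  calc ‖(f x)⁻¹‖ * ‖f x - f y‖ * ‖(f y)⁻¹‖ ≤ C * ‖f x - f y‖ * C := by gcongr
    _ = C * C * ‖f x - f y‖ := by ring

namespace GBDT

/-! ### Absolute continuity of matrix functions. -/

section AbsolutelyContinuous

variable {a b d : Type} {D : Set ℝ}

theorem LocallyAbsContOn.mono {F : ℝ → Matrix a b ℂ} {E : Set ℝ} (hF : LocallyAbsContOn F D)
    (h : E ⊆ D) : LocallyAbsContOn F E :=
  fun s t hst => hF s t (hst.trans h)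

theorem LocallyAbsContOn.const (M : Matrix a b ℂ) : LocallyAbsContOn (fun _ => M) D :=
  fun s t _ i j => .const (M i j) s t

theorem LocallyAbsContOn.sub {F G : ℝ → Matrix a b ℂ} (hF : LocallyAbsContOn F D)
    (hG : LocallyAbsContOn G D) : LocallyAbsContOn (fun x => F x - G x) D :=
  fun s t hst i j => (hF s t hst i j).fun_sub (hG s t hst i j)

theorem LocallyAbsContOn.const_smul {F : ℝ → Matrix a b ℂ} (z : ℂ) (hF : LocallyAbsContOn F D) :
    LocallyAbsContOn (fun x => z • F x) D :=
  fun s t hst i j => (hF s t hst i j).const_smul z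

theorem LocallyAbsContOn.mul [Fintype b] {F : ℝ → Matrix a b ℂ} {G : ℝ → Matrix b d ℂ}
    (hF : LocallyAbsContOn F D) (hG : LocallyAbsContOn G D) :
    LocallyAbsContOn (fun x => F x * G x) D := by
  intro s t hst i j
  simp only [Matrix.mul_apply]
  exact .finset_sum _ fun k _ => (hF s t hst i k).complex_mul (hG s t hst k j)

theorem LocallyAbsContOn.conjTranspose {F : ℝ → Matrix a b ℂ} (hF : LocallyAbsContOn F D) :
    LocallyAbsContOn (fun x => (F x)ᴴ) D :=
  fun s t hst i j => (hF s t hst j i).complex_star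

theorem absolutelyContinuousOnInterval_det [Fintype a] [DecidableEq a] {F : ℝ → Matrix a a ℂ}
    {s t : ℝ} (hF : ∀ i j, AbsolutelyContinuousOnInterval (fun x => F x i j) s t) :
    AbsolutelyContinuousOnInterval (fun x => (F x).det) s t := by
  simp only [Matrix.det_apply']
  exact .finset_sum _ fun σ _ => (AbsolutelyContinuousOnInterval.const _ s t).complex_mul
    (.finset_prod _ fun i _ => hF _ _)

/-- By Cramer's rule each entry of the inverse is a determinant in the entries of `F`, divided by
the nonvanishing `det F`. -/
theorem LocallyAbsContOn.inv [Fintype a] [DecidableEq a] {F : ℝ → Matrix a a ℂ}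
    (hF : LocallyAbsContOn F D) (h : ∀ x ∈ D, IsUnit (F x)) :
    LocallyAbsContOn (fun x => (F x)⁻¹) D := by
  intro s t hst i j
  simp only [Matrix.inv_def, Matrix.smul_apply, Ring.inverse_eq_inv', smul_eq_mul,
    Matrix.adjugate_apply]
  refine ((absolutelyContinuousOnInterval_det (hF s t hst)).complex_inv fun x hx =>
    ((Matrix.isUnit_iff_isUnit_det _).1 (h x (hst hx))).ne_zero).complex_mul
    (absolutelyContinuousOnInterval_det fun k l => ?_)
  simp only [Matrix.updateRow_apply]
  split_ifs
  · exact .const _ s t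
  · exact hF s t hst k l

end AbsolutelyContinuous

/-! ### Entrywise derivatives of matrix functions. -/

section Derivative

variable {𝕜 : Type} [NontriviallyNormedField 𝕜] [NormedAlgebra 𝕜 ℂ] {a b d : Type}
  {s : Set 𝕜} {x : 𝕜}

theorem HasMatDerivWithinAt.const (M : Matrix a b ℂ) :
    HasMatDerivWithinAt (fun _ => M) 0 s x :=
  fun i j => hasDerivWithinAt_const x s (M i j)

theorem HasMatDerivWithinAt.sub {F G : 𝕜 → Matrix a b ℂ} {F' G' : Matrix a b ℂ}
    (hF : HasMatDerivWithinAt F F' s x) (hG : HasMatDerivWithinAt G G' s x) :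
    HasMatDerivWithinAt (fun t => F t - G t) (F' - G') s x :=
  fun i j => (hF i j).fun_sub (hG i j)

theorem HasMatDerivWithinAt.const_smul {F : 𝕜 → Matrix a b ℂ} {F' : Matrix a b ℂ} (z : ℂ)
    (hF : HasMatDerivWithinAt F F' s x) :
    HasMatDerivWithinAt (fun t => z • F t) (z • F') s x :=
  fun i j => (hF i j).const_mul z

theorem HasMatDerivWithinAt.mul [Fintype b] {F : 𝕜 → Matrix a b ℂ} {G : 𝕜 → Matrix b d ℂ}
    {F' : Matrix a b ℂ} {G' : Matrix b d ℂ}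
    (hF : HasMatDerivWithinAt F F' s x) (hG : HasMatDerivWithinAt G G' s x) :
    HasMatDerivWithinAt (fun t => F t * G t) (F' * G x + F x * G') s x := by
  intro i j
  simp only [Matrix.add_apply, Matrix.mul_apply, ← Finset.sum_add_distrib]
  exact HasDerivWithinAt.fun_sum fun k _ => (hF i k).fun_mul (hG k j)

theorem HasMatDerivWithinAt.const_mul [Fintype b] {G : 𝕜 → Matrix b d ℂ} {G' : Matrix b d ℂ}
    (M : Matrix a b ℂ) (hG : HasMatDerivWithinAt G G' s x) :
    HasMatDerivWithinAt (fun t => M * G t) (M * G') s x := by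
  simpa using (HasMatDerivWithinAt.const M).mul hG

theorem HasMatDerivWithinAt.mul_const [Fintype b] {F : 𝕜 → Matrix a b ℂ} {F' : Matrix a b ℂ}
    (hF : HasMatDerivWithinAt F F' s x) (M : Matrix b d ℂ) :
    HasMatDerivWithinAt (fun t => F t * M) (F' * M) s x := by
  simpa using hF.mul (HasMatDerivWithinAt.const M)

theorem HasMatDerivWithinAt.conjTranspose {F : ℝ → Matrix a b ℂ} {F' : Matrix a b ℂ}
    {s : Set ℝ} {x : ℝ} (hF : HasMatDerivWithinAt F F' s x) :
    HasMatDerivWithinAt (fun t => (F t)ᴴ) F'ᴴ s x :=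
  fun i j => (hF j i).star

-- Gives access to the normed-algebra calculus of inversion and the exponential.
open scoped Matrix.Norms.Operator in
theorem hasMatDerivWithinAt_iff [Fintype a] [Fintype b] {F : 𝕜 → Matrix a b ℂ}
    {F' : Matrix a b ℂ} :
    HasMatDerivWithinAt F F' s x ↔ HasDerivWithinAt F F' s x := by
  constructor
  · intro h
    have := hasDerivWithinAt_pi.2 fun i => hasDerivWithinAt_pi.2 (h i)
    exact this
  · intro h i j
    exact hasDerivWithinAt_pi.1 (hasDerivWithinAt_pi.1 h i) j

open scoped Matrix.Norms.Operator in
theorem HasMatDerivWithinAt.inv [Fintype a] [DecidableEq a] {F : 𝕜 → Matrix a a ℂ}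
    {F' : Matrix a a ℂ} (hF : HasMatDerivWithinAt F F' s x) (h : IsUnit (F x)) :
    HasMatDerivWithinAt (fun t => (F t)⁻¹) (-((F x)⁻¹ * F' * (F x)⁻¹)) s x := by
  rw [hasMatDerivWithinAt_iff] at hF ⊢
  obtain ⟨u, hu⟩ := h
  have h1 := hasFDerivAt_ringInverse (𝕜 := 𝕜) u
  rw [hu] at h1
  have h2 := h1.comp_hasDerivWithinAt x hF
  have h3 : (F x)⁻¹ = ↑u⁻¹ := by rw [← hu, Matrix.coe_units_inv]
  simp only [Matrix.nonsing_inv_eq_ringInverse] at h3 ⊢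
  rw [h3]
  exact h2

open scoped Matrix.Norms.Operator in
theorem hasMatDerivWithinAt_exp_add_smul [Fintype a] [DecidableEq a] {B R : Matrix a a ℂ}
    (h : Commute B R) (z : ℂ) :
    HasMatDerivWithinAt (fun w : ℂ => NormedSpace.exp (B + w • R))
      (R * NormedSpace.exp (B + z • R)) Set.univ z := by
  have h1 : (fun w : ℂ => NormedSpace.exp (B + w • R)) =
      fun w => NormedSpace.exp B * NormedSpace.exp (w • R) :=
    funext fun w => Matrix.exp_add_of_commute _ _ (h.smul_right w)
  have h2 : R * NormedSpace.exp (B + z • R) =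
      NormedSpace.exp B * (R * NormedSpace.exp (z • R)) := by
    rw [congrFun h1 z, ← mul_assoc, ← mul_assoc, h.symm.exp_right.eq]
  rw [h1, h2]
  refine HasMatDerivWithinAt.const_mul _ ?_
  rw [hasMatDerivWithinAt_iff]
  exact (hasDerivAt_exp_smul_const' R z).hasDerivWithinAt

end Derivative

/-! ### Conserved quantities and the matrix identity. -/

theorem LocallyAbsContOn.eq_of_ae_hasMatDerivWithinAt_zero {a b : Type} {F : ℝ → Matrix a b ℂ}
    {I : Set ℝ} (hI : I.OrdConnected) (hF : LocallyAbsContOn F I)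
    (hF' : ∀ᵐ x : ℝ, x ∈ I → HasMatDerivWithinAt F 0 I x) {x y : ℝ} (hx : x ∈ I) (hy : y ∈ I) :
    F x = F y := by
  have hsub : Set.uIcc x y ⊆ I := hI.uIcc_subset hx hy
  ext i j
  obtain ⟨C, hC⟩ := (hF x y hsub i j).const_of_ae_hasDerivAt_zero (by
    -- Off the null set `{x, y}`, `t` is interior to `uIcc x y`, so the derivative within `I` is
    -- two-sided.
    filter_upwards [hF', Measure.ae_ne volume x, Measure.ae_ne volume y] with t ht htx hty htI
    refine (ht (hsub htI) i j).hasDerivAt (Filter.mem_of_superset ?_ hsub)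
    refine Icc_mem_nhds (lt_of_le_of_ne htI.1 ?_) (lt_of_le_of_ne htI.2 ?_)
    · rcases min_choice x y with h | h <;> rw [h] <;> exact Ne.symm ‹_›
    · rcases max_choice x y with h | h <;> rw [h] <;> assumption)
  exact (hC x Set.left_mem_uIcc).trans (hC y Set.right_mem_uIcc).symm

variable {m₁ m₂ p n r : ℕ}

theorem sigMat_mul_self : sigMat m₁ m₂ * sigMat m₁ m₂ = 1 := by
  simp [sigMat, Matrix.fromBlocks_multiply]

theorem sigMat_mul_cancel {b : Type} (M : Matrix (Fin m₁ ⊕ Fin m₂) b ℂ) :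
    sigMat m₁ m₂ * (sigMat m₁ m₂ * M) = M := by
  rw [← Matrix.mul_assoc, sigMat_mul_self, Matrix.one_mul]

theorem conjTranspose_sigMat : (sigMat m₁ m₂)ᴴ = sigMat m₁ m₂ := by
  simp [sigMat, Matrix.fromBlocks_conjTranspose]

theorem conjTranspose_ham (β : Fin r → ℝ → Matrix (Fin p) (Fin m₁ ⊕ Fin m₂) ℂ) (k : Fin r)
    (x : ℝ) : (ham β k x)ᴴ = ham β k x := by
  simp [ham, Matrix.conjTranspose_mul]

theorem conjTranspose_resolv (A : Matrix (Fin n) (Fin n) ℂ) (c : ℝ) :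
    (resolv A c)ᴴ = resolv Aᴴ c := by
  simp [resolv, Matrix.conjTranspose_nonsing_inv]

theorem isUnit_sub_smul_one {A : Matrix (Fin n) (Fin n) ℂ} {z : ℂ} (h : z ∉ spectrum ℂ A) :
    IsUnit (A - z • (1 : Matrix (Fin n) (Fin n) ℂ)) := by
  rw [spectrum.notMem_iff, Algebra.algebraMap_eq_smul_one] at h
  simpa using h.neg

theorem mul_resolv {A : Matrix (Fin n) (Fin n) ℂ} {z : ℂ} (h : z ∉ spectrum ℂ A) :
    A * resolv A z = 1 + z • resolv A z := by
  have h1 := Matrix.mul_nonsing_inv _ ((Matrix.isUnit_iff_isUnit_det _).1 (isUnit_sub_smul_one h))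
  rw [← resolv, Matrix.sub_mul, Matrix.smul_mul, Matrix.one_mul] at h1
  rw [← h1, sub_add_cancel]

theorem resolv_commute (A : Matrix (Fin n) (Fin n) ℂ) (z w : ℂ) :
    Commute (resolv A z) (resolv A w) := by
  simp only [resolv, Matrix.nonsing_inv_eq_ringInverse]
  refine Commute.ringInverse_ringInverse ?_
  exact ((Commute.refl A).sub_right ((Commute.one_right A).smul_right w)).sub_left
    (((Commute.one_left _).smul_left z))

theorem conjTranspose_resolv_mul {A : Matrix (Fin n) (Fin n) ℂ} {c : ℝ}
    (h : (c : ℂ) ∉ spectrum ℂ A) :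
    resolv Aᴴ c * Aᴴ = 1 + (c : ℂ) • resolv Aᴴ c := by
  simpa [Matrix.conjTranspose_mul, conjTranspose_resolv] using
    congrArg Matrix.conjTranspose (mul_resolv h)

variable {A : Matrix (Fin n) (Fin n) ℂ} {c : Fin r → ℝ}
  {β : Fin r → ℝ → Matrix (Fin p) (Fin m₁ ⊕ Fin m₂) ℂ}
  {P : ℝ → Matrix (Fin n) (Fin m₁ ⊕ Fin m₂) ℂ} {S : ℝ → Matrix (Fin n) (Fin n) ℂ}
  {I : Set ℝ} {x : ℝ}

theorem conjTranspose_rhsS : (rhsS A c β P x)ᴴ = rhsS A c β P x := by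
  simp [rhsS, Matrix.conjTranspose_mul, Matrix.conjTranspose_sum, conjTranspose_sigMat,
    conjTranspose_ham, ← conjTranspose_resolv, Matrix.mul_assoc]

theorem conjTranspose_rhsPi : (rhsPi A c β P x)ᴴ =
    Complex.I • ∑ k, ham β k x * sigMat m₁ m₂ * (P x)ᴴ * resolv Aᴴ (c k) := by
  simp [rhsPi, Matrix.conjTranspose_mul, Matrix.conjTranspose_sum, conjTranspose_sigMat,
    conjTranspose_ham, conjTranspose_resolv, Matrix.mul_assoc]

/-- The differentiated form of `A S - S A^* = i Π j Π^*`. Substituting `A R_k = 1 + c_k R_k` and its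
adjoint, the `c_k` terms cancel because `c_k` is real. -/
theorem node_rhs (hA : ∀ k, (c k : ℂ) ∉ spectrum ℂ A) :
    A * rhsS A c β P x - rhsS A c β P x * Aᴴ =
      Complex.I • (rhsPi A c β P x * sigMat m₁ m₂ * (P x)ᴴ +
        P x * sigMat m₁ m₂ * (rhsPi A c β P x)ᴴ) := by
  rw [conjTranspose_rhsPi]
  simp only [rhsS, rhsPi, Matrix.mul_neg, Matrix.neg_mul, Matrix.mul_sum, Matrix.sum_mul,
    Matrix.smul_mul, Matrix.mul_smul, smul_add, smul_neg, smul_smul, Complex.I_mul_I, neg_smul,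
    one_smul, neg_neg, ← Finset.sum_neg_distrib, ← Finset.sum_add_distrib,
    ← Finset.sum_sub_distrib]
  refine Finset.sum_congr rfl fun k _ => ?_
  simp only [Matrix.mul_assoc, conjTranspose_resolv_mul (hA k)]
  simp only [← Matrix.mul_assoc A, mul_resolv (hA k)]
  simp only [Matrix.add_mul, Matrix.mul_add, Matrix.one_mul, Matrix.mul_one, Matrix.smul_mul,
    Matrix.mul_smul]
  abel

theorem conjTranspose_eq_of_solvesODEOn (hI : I.OrdConnected) (h0 : (0 : ℝ) ∈ I)
    (hS0 : S 0 = (S 0)ᴴ) (hS : SolvesODEOn S (rhsS A c β P) I) (hx : x ∈ I) :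
    (S x)ᴴ = S x := by
  have h := (hS.1.sub hS.1.conjTranspose).eq_of_ae_hasMatDerivWithinAt_zero hI (by
    filter_upwards [hS.2] with t ht htI
    simpa [conjTranspose_rhsS] using (ht htI).sub (ht htI).conjTranspose) hx h0
  simp only [← hS0, sub_self] at h
  exact (sub_eq_zero.1 h).symm

theorem node_of_solvesODEOn (hI : I.OrdConnected) (h0 : (0 : ℝ) ∈ I)
    (hA : ∀ k, (c k : ℂ) ∉ spectrum ℂ A)
    (hnode : A * S 0 - S 0 * Aᴴ = Complex.I • (P 0 * sigMat m₁ m₂ * (P 0)ᴴ))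
    (hP : SolvesODEOn P (rhsPi A c β P) I) (hS : SolvesODEOn S (rhsS A c β P) I) (hx : x ∈ I) :
    A * S x - S x * Aᴴ = Complex.I • (P x * sigMat m₁ m₂ * (P x)ᴴ) := by
  have hac := (((LocallyAbsContOn.const A).mul hS.1).sub (hS.1.mul (.const Aᴴ))).sub
    (((hP.1.mul (.const (sigMat m₁ m₂))).mul hP.1.conjTranspose).const_smul Complex.I)
  have h := hac.eq_of_ae_hasMatDerivWithinAt_zero hI (by
    filter_upwards [hP.2, hS.2] with t hPt hSt htI
    have hd := (((hSt htI).const_mul A).sub ((hSt htI).mul_const Aᴴ)).sub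
      ((((hPt htI).mul_const (sigMat m₁ m₂)).mul (hPt htI).conjTranspose).const_smul Complex.I)
    rwa [node_rhs hA, sub_self] at hd) hx h0
  simp only [hnode, sub_self] at h
  exact sub_eq_zero.1 h

/-! ### The transfer function and the dynamical system. -/

theorem transfer_conjTranspose_mul {z : ℝ} (hz : (z : ℂ) ∉ spectrum ℂ A)
    (hSx : IsUnit (S x)) (hSh : (S x)ᴴ = S x)
    (hnode : A * S x - S x * Aᴴ = Complex.I • (P x * sigMat m₁ m₂ * (P x)ᴴ)) :
    (transfer A P S x z)ᴴ * (P x)ᴴ * (S x)⁻¹ * resolv A z =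
      (P x)ᴴ * resolv Aᴴ z * (S x)⁻¹ := by
  have hdet := (Matrix.isUnit_iff_isUnit_det _).1 hSx
  have hN : Complex.I • (P x * sigMat m₁ m₂ * (P x)ᴴ) =
      (A - (z : ℂ) • 1) * S x - S x * (Aᴴ - (z : ℂ) • 1) := by
    rw [← hnode]
    simp [Matrix.sub_mul, Matrix.mul_sub]
  have h1 : (A - (z : ℂ) • 1) * resolv A z = 1 := by
    rw [Matrix.sub_mul, mul_resolv hz]; simp
  have h2 : resolv Aᴴ z * (Aᴴ - (z : ℂ) • 1) = 1 := by
    rw [Matrix.mul_sub, conjTranspose_resolv_mul hz]; simp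
  -- By `hN` the middle factor is `(A - z) S - S (A^* - z)`; in each term the factors next to `S⁻¹`
  -- and one resolvent cancel.
  have hmid : resolv Aᴴ z * (S x)⁻¹ * (Complex.I • (P x * sigMat m₁ m₂ * (P x)ᴴ)) * (S x)⁻¹ *
      resolv A z = resolv Aᴴ z * (S x)⁻¹ - (S x)⁻¹ * resolv A z := by
    rw [hN, Matrix.mul_sub, Matrix.sub_mul, Matrix.sub_mul]
    congr 1
    · calc _ = resolv Aᴴ z * (S x)⁻¹ * ((A - (z : ℂ) • 1) * (S x * (S x)⁻¹) * resolv A z) := by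
            simp only [Matrix.mul_assoc]
        _ = _ := by rw [Matrix.mul_nonsing_inv _ hdet, Matrix.mul_one, h1, Matrix.mul_one]
    · calc _ = resolv Aᴴ z * ((S x)⁻¹ * S x) * (Aᴴ - (z : ℂ) • 1) * (S x)⁻¹ * resolv A z := by
            simp only [Matrix.mul_assoc]
        _ = _ := by rw [Matrix.nonsing_inv_mul _ hdet, Matrix.mul_one, h2, Matrix.one_mul]
  have ht : (transfer A P S x z)ᴴ =
      1 + Complex.I • ((P x)ᴴ * resolv Aᴴ z * (S x)⁻¹ * P x * sigMat m₁ m₂) := by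
    simp [transfer, Matrix.conjTranspose_mul, conjTranspose_sigMat, conjTranspose_resolv,
      Matrix.conjTranspose_nonsing_inv, hSh, Matrix.mul_assoc]
  calc _ = (P x)ᴴ * ((S x)⁻¹ * resolv A z + resolv Aᴴ z * (S x)⁻¹ *
        (Complex.I • (P x * sigMat m₁ m₂ * (P x)ᴴ)) * (S x)⁻¹ * resolv A z) := by
        rw [ht]
        simp only [Matrix.add_mul, Matrix.mul_add, Matrix.one_mul, Matrix.smul_mul,
          Matrix.mul_smul, Matrix.mul_assoc]
    _ = _ := by rw [hmid, add_sub_cancel, Matrix.mul_assoc]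

theorem hasMatDerivWithinAt_exp_update (ζ : Fin r → ℂ) (k : Fin r) :
    HasMatDerivWithinAt
      (fun s : ℂ => NormedSpace.exp (∑ l, Function.update ζ k s l • resolv A (c l)))
      (resolv A (c k) * NormedSpace.exp (∑ l, ζ l • resolv A (c l))) Set.univ (ζ k) := by
  -- Only the `k`-th summand depends on `s`, and it commutes with the others.
  have hsum : ∀ s : ℂ, ∑ l, Function.update ζ k s l • resolv A (c l) =
      ∑ l ∈ Finset.univ.erase k, ζ l • resolv A (c l) + s • resolv A (c k) := by
    intro s
    rw [← Finset.sum_erase_add _ _ (Finset.mem_univ k), Function.update_self]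
    congr 1
    exact Finset.sum_congr rfl fun l hl => by
      rw [Function.update_of_ne (Finset.ne_of_mem_erase hl)]
  have hk := hsum (ζ k)
  rw [Function.update_eq_self] at hk
  simp only [hsum, hk]
  exact hasMatDerivWithinAt_exp_add_smul
    (Commute.sum_left _ _ _ fun l _ => (resolv_commute A _ _).smul_left _) _

/-- The derivative of `j Π^* S⁻¹`, expressed through the transformed Hamiltonians. -/
theorem hasMatDerivWithinAt_sigMat_mul_conjTranspose_mul_inv
    (hA : ∀ k, (c k : ℂ) ∉ spectrum ℂ A) (hSx : IsUnit (S x)) (hSh : (S x)ᴴ = S x)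
    (hnode : A * S x - S x * Aᴴ = Complex.I • (P x * sigMat m₁ m₂ * (P x)ᴴ))
    (hP : HasMatDerivWithinAt P (rhsPi A c β P x) I x)
    (hS : HasMatDerivWithinAt S (rhsS A c β P x) I x) :
    HasMatDerivWithinAt (fun t => sigMat m₁ m₂ * (P t)ᴴ * (S t)⁻¹)
      (Complex.I • ∑ k, sigMat m₁ m₂ * ham (transBeta A c β P S) k x *
        (sigMat m₁ m₂ * (P x)ᴴ * (S x)⁻¹ * resolv A (c k))) I x := by
  convert (hP.conjTranspose.const_mul (sigMat m₁ m₂)).mul (hS.inv hSx) using 1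
  rw [conjTranspose_rhsPi]
  simp only [rhsS, Matrix.mul_neg, Matrix.neg_mul, neg_neg, Matrix.mul_sum, Matrix.sum_mul,
    Matrix.smul_mul, Matrix.mul_smul, Finset.smul_sum, ← Finset.sum_add_distrib]
  refine Finset.sum_congr rfl fun k _ => ?_
  -- `H̃_k = j w_A j H_k j w_A^* j`, and its outer factors `j` cancel against the neighbouring ones.
  have h1 : sigMat m₁ m₂ * ham (transBeta A c β P S) k x *
      (sigMat m₁ m₂ * (P x)ᴴ * (S x)⁻¹ * resolv A (c k)) =
      transfer A P S x (c k) * sigMat m₁ m₂ * ham β k x * sigMat m₁ m₂ *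
        ((transfer A P S x (c k))ᴴ * (P x)ᴴ * (S x)⁻¹ * resolv A (c k)) := by
    simp [ham, transBeta, Matrix.conjTranspose_mul, conjTranspose_sigMat, Matrix.mul_assoc,
      sigMat_mul_cancel]
  rw [h1, transfer_conjTranspose_mul (hA k) hSx hSh hnode]
  -- In the remaining factor `w_A`, the summand `1` accounts for `(Π^*)'` and the other one for
  -- `(S⁻¹)'`.
  simp only [transfer, Matrix.sub_mul, Matrix.one_mul, Matrix.smul_mul, smul_sub, smul_smul,
    Complex.I_mul_I, neg_smul, one_smul, sub_neg_eq_add, Matrix.mul_assoc]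

theorem dynSystemAt_psiTilde (hA : ∀ k, (c k : ℂ) ∉ spectrum ℂ A) (hSx : IsUnit (S x))
    (hSh : (S x)ᴴ = S x)
    (hnode : A * S x - S x * Aᴴ = Complex.I • (P x * sigMat m₁ m₂ * (P x)ᴴ))
    (hP : HasMatDerivWithinAt P (rhsPi A c β P x) I x)
    (hS : HasMatDerivWithinAt S (rhsS A c β P x) I x) :
    DynSystemAt (ham (transBeta A c β P S)) (psiTilde A c P S) I x := by
  refine fun ζ => ⟨fun k => sigMat m₁ m₂ * (P x)ᴴ * (S x)⁻¹ *
    (resolv A (c k) * NormedSpace.exp (∑ l, ζ l • resolv A (c l))),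
    fun k => (hasMatDerivWithinAt_exp_update ζ k).const_mul _, ?_⟩
  convert (hasMatDerivWithinAt_sigMat_mul_conjTranspose_mul_inv hA hSx hSh hnode hP hS).mul_const
    (NormedSpace.exp (∑ l, ζ l • resolv A (c l))) using 1
  any_goals rfl
  simp only [Matrix.smul_mul, Matrix.sum_mul, Matrix.mul_assoc]

end GBDT

theorem theorem4p1 {m₁ m₂ p n r : ℕ} (hm : 0 < m₁ + m₂) (hp : p ≤ m₁ + m₂) (hn : 0 < n)
    (I : Set ℝ) (hI : I.OrdConnected) (h0 : (0 : ℝ) ∈ I)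
    (c : Fin r → ℝ) (β : Fin r → ℝ → Matrix (Fin p) (Fin m₁ ⊕ Fin m₂) ℂ)
    (hH : ∀ k i j, LocallyIntegrableOn (fun x => GBDT.ham β k x i j) I volume)
    (A : Matrix (Fin n) (Fin n) ℂ) (hA : ∀ k, (c k : ℂ) ∉ spectrum ℂ A)
    (P : ℝ → Matrix (Fin n) (Fin m₁ ⊕ Fin m₂) ℂ) (S : ℝ → Matrix (Fin n) (Fin n) ℂ)
    (hnode : A * S 0 - S 0 * Aᴴ = Complex.I • (P 0 * GBDT.sigMat m₁ m₂ * (P 0)ᴴ))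
    (hS0 : S 0 = (S 0)ᴴ)
    (hP : GBDT.SolvesODEOn P (GBDT.rhsPi A c β P) I)
    (hS : GBDT.SolvesODEOn S (GBDT.rhsS A c β P) I) :
    (∀ ζ : Fin r → ℂ, GBDT.LocallyAbsContOn (fun x => GBDT.psiTilde A c P S x ζ)
        {x | x ∈ I ∧ IsUnit (S x)}) ∧
    (∀ᵐ x : ℝ, x ∈ I → IsUnit (S x) →
      GBDT.DynSystemAt (GBDT.ham (GBDT.transBeta A c β P S)) (GBDT.psiTilde A c P S) I x) ∧
    (∀ x ∈ I, IsUnit (S x) →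
      GBDT.HasMatDerivWithinAt P (GBDT.rhsPi A c β P x) I x →
      GBDT.HasMatDerivWithinAt S (GBDT.rhsS A c β P x) I x →
      GBDT.DynSystemAt (GBDT.ham (GBDT.transBeta A c β P S)) (GBDT.psiTilde A c P S) I x) := by
  have key : ∀ x ∈ I, IsUnit (S x) →
      GBDT.HasMatDerivWithinAt P (GBDT.rhsPi A c β P x) I x →
      GBDT.HasMatDerivWithinAt S (GBDT.rhsS A c β P x) I x →
      GBDT.DynSystemAt (GBDT.ham (GBDT.transBeta A c β P S)) (GBDT.psiTilde A c P S) I x :=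
    fun x hx hSx hPx hSx' => GBDT.dynSystemAt_psiTilde hA hSx
      (GBDT.conjTranspose_eq_of_solvesODEOn hI h0 hS0 hS hx)
      (GBDT.node_of_solvesODEOn hI h0 hA hnode hP hS hx) hPx hSx'
  refine ⟨fun ζ => ?_, ?_, key⟩
  · have hsub : {x | x ∈ I ∧ IsUnit (S x)} ⊆ I := fun x hx => hx.1
    exact (((GBDT.LocallyAbsContOn.const _).mul (hP.1.mono hsub).conjTranspose).mul
      ((hS.1.mono hsub).inv fun x hx => hx.2)).mul (.const _)
  · filter_upwards [hP.2, hS.2] with x hPx hSx hx hux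
    exact key x hx hux (hPx hx) (hSx hx)
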